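/- **Conventions.** A partial function $F:\{0,1\}^*\times\{0,1\}^{\mathbb N}\rightharpoonup\{0,1\}^*$ is *computable* if one oracle algorithm computes $F(x,\mathbf o)$ from the input $x$ for every oracle $\mathbf o$ (and diverges where $F$ is undefined). Put $\langle p,x\rangle:=1^{|p|}0px$. A computable $U$ is *universal* if for every computable $F$ there is a $p\in\{0,1\}^*$ with $F(x,\mathbf o)=U(\langle p,x\rangle,\mathbf o)$ for all $x,\mathbf o$ (as partial functions). Fix a universal $U$ and let $K[x\,|\,\mathbf o]:=\min\{|p| : U(p,\mathbf o)=x\}$. For $s\in[0,1]$, the greedy binary expansion of $s$ is its lexicographically largest binary expansion; it is generated by setting $r_0=s$ and, for $i\ge 1$, taking the $i$-th digit to be $b_i=0$ if $r_{i-1}<1/2$ and $b_i=1$ otherwise, with $r_i=2r_{i-1}-b_i$. For $\beta\in(1,2)$ let $K[x\,|\,\beta]:=K[x\,|\,\mathbf y_\beta]$, where $\mathbf y_\beta$ is the greedy binary expansion of $\beta-1$. Let $n(\beta):=\lceil n\log_\beta 2\rceil$ and $$\Omega_\beta:=\Big\{\mathbf x\in\{0,1\}^{\mathbb N} : \sum_{i\ge1}\mathbf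 x_i\beta^{-i}\le 1\Big\}.$$ For $\mathbf x\in\Omega_\beta$ let $\mathbf y=\mathbf y(\mathbf x)$ be the greedy binary expansion of $\sum_{i\ge 1}\mathbf x_i\beta^{-i}$, and let $$\underline\Delta_\beta(\mathbf x):=\liminf_{n\to\infty}\frac{K[\mathbf x_{1:n(\beta)}|\beta]-K[\mathbf y_{1:n}|\beta]}{n},\qquad \overline\Delta_\beta(\mathbf x):=\limsup_{n\to\infty}\frac{K[\mathbf x_{1:n(\beta)}|\beta]-K[\mathbf y_{1:n}|\beta]}{n}.$$ **Theorem.** Let $\beta\in(1,2)$. There is a constant $C$ (depending only on $\beta$ and $U$) such that for all $\mathbf x\in\Omega_\beta$ and all $n\in\mathbb N$ $$K[\mathbf y_{1:n}|\beta]\le K[\mathbf x_{1:n(\beta)}|\beta]+C .$$ In particular, for all $\mathbf x\in\Omega_\beta$, $$0\le\underline\Delta_\beta(\mathbf x)\le\overline\Delta_\beta(\mathbf x).$$ -/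

import Mathlib

open Filter

noncomputable section

namespace BetaExp

/-- Partial functionals `F o : ℕ →. ℕ` that are partial recursive uniformly in the oracle
`o : ℕ → Bool`: the least class that contains zero, successor, the two projections of the
pairing function and the oracle query `n ↦ o n`, and is closed under pairing, composition,
primitive recursion and unbounded search. One construction has to work for all oracles. -/
inductive OraclePartrec : ((ℕ → Bool) → ℕ →. ℕ) → Prop
  | zero : OraclePartrec fun _ => fun _ => Part.some 0
  | succ : OraclePartrec fun _ => fun n => Part.some (n + 1)
  | left : OraclePartrec fun _ => fun n => Part.some n.unpair.1
  | right : OraclePartrec fun _ => fun n => Part.some n.unpair.2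
  | query : OraclePartrec fun o => fun n => Part.some (o n).toNat
  | pair {F G : (ℕ → Bool) → ℕ →. ℕ} : OraclePartrec F → OraclePartrec G →
      OraclePartrec fun o => fun n => Nat.pair <$> F o n <*> G o n
  | comp {F G : (ℕ → Bool) → ℕ →. ℕ} : OraclePartrec F → OraclePartrec G →
      OraclePartrec fun o => fun n => G o n >>= F o
  | prec {F G : (ℕ → Bool) → ℕ →. ℕ} : OraclePartrec F → OraclePartrec G →
      OraclePartrec fun o => Nat.unpaired fun a n =>
        n.rec (F o a) fun y IH => do let i ← IH; G o (Nat.pair a (Nat.pair y i))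
  | rfind {F : (ℕ → Bool) → ℕ →. ℕ} : OraclePartrec F →
      OraclePartrec fun o => fun a =>
        Nat.rfind fun n => (fun m => m = 0) <$> F o (Nat.pair a n)

/-- Computable (partial) functions `{0,1}* × {0,1}^ℕ ⇀ {0,1}*`; `F o x` is the value on the
finite input `x` with the infinite sequence `o` as oracle. -/
def IsComputable (F : (ℕ → Bool) → List Bool →. List Bool) : Prop :=
  OraclePartrec fun o => fun n =>
    Part.bind (Encodable.decode (α := List Bool) n) fun x => (F o x).map Encodable.encode

/-- The pairing `⟨p, x⟩ = 1^{|p|} 0 p x`. -/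
def pairing (p x : List Bool) : List Bool :=
  List.replicate p.length true ++ false :: (p ++ x)

/-- `U` is a universal computable function: it is computable, and every computable `F` has a
program `p` with `F(x, o) = U(⟨p, x⟩, o)` for all `x` and `o` (as partial functions). -/
def IsUniversal (U : (ℕ → Bool) → List Bool →. List Bool) : Prop :=
  IsComputable U ∧
    ∀ F : (ℕ → Bool) → List Bool →. List Bool, IsComputable F →
      ∃ p : List Bool, ∀ (o : ℕ → Bool) (x : List Bool), F o x = U o (pairing p x)

/-- The algorithmic complexity `K_U[x | o]`: the least length of a `p` with `U(p, o) = x`. -/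
def complexity (U : (ℕ → Bool) → List Bool →. List Bool) (x : List Bool) (o : ℕ → Bool) : ℕ :=
  sInf {l : ℕ | ∃ p : List Bool, p.length = l ∧ x ∈ U o p}

/-- The prefix of length `n`. Sequences are indexed from `0`: the `i`-th digit is `x (i - 1)`. -/
def prefixOf (x : ℕ → Bool) (n : ℕ) : List Bool :=
  (List.range n).map x

/-- The remainder `r` of the greedy binary algorithm on input `s` after `n` steps. -/
def greedyRem (s : ℝ) : ℕ → ℝ
  | 0 => s
  | n + 1 => if greedyRem s n < 1 / 2 then 2 * greedyRem s n else 2 * greedyRem s n - 1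

/-- The greedy binary expansion of `s ∈ [0, 1]`. -/
def greedyBinary (s : ℝ) (n : ℕ) : Bool :=
  if greedyRem s n < 1 / 2 then false else true

/-- The number `∑_{i ≥ 1} x_i β^{-i}`. -/
def value (β : ℝ) (x : ℕ → Bool) : ℝ :=
  ∑' i : ℕ, ((x i).toNat : ℝ) * (β ^ (i + 1))⁻¹

/-- `Ω_β`: the sequences that are a `β`-expansion of a number in `[0, 1]`. -/
def Omega (β : ℝ) : Set (ℕ → Bool) :=
  {x | value β x ≤ 1}

/-- `n(β) = ⌈n log_β 2⌉`. -/
def betaLength (β : ℝ) (n : ℕ) : ℕ :=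
  ⌈(n : ℝ) * Real.logb β 2⌉₊

/-- `K[x | β]`: complexity relative to the greedy binary expansion of `β - 1`. -/
def complexityRel (U : (ℕ → Bool) → List Bool →. List Bool) (β : ℝ) (x : List Bool) : ℕ :=
  complexity U x (greedyBinary (β - 1))

/-- `(K[x_{1:n(β)} | β] - K[y_{1:n} | β]) / n`, where `y` is the greedy binary expansion of the
number that `x` represents in base `β`. -/
def complexityGap (U : (ℕ → Bool) → List Bool →. List Bool) (β : ℝ) (x : ℕ → Bool) (n : ℕ) : ℝ :=
  ((complexityRel U β (prefixOf x (betaLength β n)) : ℝ) -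
    (complexityRel U β (prefixOf (greedyBinary (value β x)) n) : ℝ)) / (n : ℝ)

/-- The lower relative complexity, as an extended real. -/
def lowerDelta (U : (ℕ → Bool) → List Bool →. List Bool) (β : ℝ) (x : ℕ → Bool) : EReal :=
  liminf (fun n : ℕ => (complexityGap U β x n : EReal)) atTop

/-- The upper relative complexity, as an extended real. -/
def upperDelta (U : (ℕ → Bool) → List Bool →. List Bool) (β : ℝ) (x : ℕ → Bool) : EReal :=
  limsup (fun n : ℕ => (complexityGap U β x n : EReal)) atTop

end BetaExp

end

/-!
Fix `x ∈ Ω_β` and put `m = n(β)`. The digits of `x` after the first `m` contribute at most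
`β^{-m} / (β - 1) ≤ 2^{-n} / (β - 1)` to the number represented by `x`, so the prefix `x_{1:m}`
determines the first `n` binary digits of that number up to boundedly many possibilities. The
point is that these possibilities can be listed effectively from `x_{1:m}` and an oracle for `β`
(the greedy binary expansion of `β - 1`).

The first `3m` oracle bits give an integer `b` with `b ≤ 8^m β ≤ b + 1`. Two integers computed
from `b` and `x_{1:m}` then suffice: the largest `k` with `2^k ≤ (b / 8^m)^m`, which is `n` or
`n - 1` (`lengthEstimate_betaLength`), and the integer part of `2^n` times the value of `x_{1:m}`
in base `b / 8^m`, which differs boundedly from the integer whose binary digits are `y_{1:n}`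
(`exists_decodePrefix`). For each of the finitely many values of the two corrections, the map
`decodePrefix` is primitive recursive, and applying it to the output of the universal machine is
computable with oracle `β`. Universality turns this into a program that is longer by a constant
(`complexity_postprocess_le`), and the sum of these constants bounds all the cases at once. The
statement on the lower limit follows on dividing by `n`.
-/

open Filter

namespace BetaExp

/-! ### Computability relative to an oracle -/

theorem OraclePartrec.of_partrec {f : ℕ →. ℕ} (hf : Nat.Partrec f) :
    OraclePartrec fun _ => f := by
  induction hf with
  | zero => exact .zero
  | succ => exact .succ
  | left => exact .left
  | right => exact .right
  | pair _ _ hf hg => exact .pair hf hg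
  | comp _ _ hf hg => exact .comp hf hg
  | prec _ _ hf hg => exact .prec hf hg
  | rfind _ hf => exact .rfind hf

theorem OraclePartrec.of_primrec {f : ℕ → ℕ} (hf : Primrec f) :
    OraclePartrec fun _ n => Part.some (f n) :=
  .of_partrec (Nat.Partrec.of_primrec (Primrec.nat_iff.1 hf))

theorem OraclePartrec.comp_total {f g : (ℕ → Bool) → ℕ → ℕ}
    (hf : OraclePartrec fun o n => Part.some (f o n))
    (hg : OraclePartrec fun o n => Part.some (g o n)) :
    OraclePartrec fun o n => Part.some (f o (g o n)) := by
  have h := OraclePartrec.comp hf hg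
  simpa using h

theorem OraclePartrec.pair_total {f g : (ℕ → Bool) → ℕ → ℕ}
    (hf : OraclePartrec fun o n => Part.some (f o n))
    (hg : OraclePartrec fun o n => Part.some (g o n)) :
    OraclePartrec fun o n => Part.some (Nat.pair (f o n) (g o n)) := by
  have h := OraclePartrec.pair hf hg
  simpa [Seq.seq] using h

/-- The natural number whose binary expansion is that of `c` followed by the first `n` digits
of `y`. -/
def prefixNat (c : ℕ) (y : ℕ → Bool) : ℕ → ℕ
  | 0 => c
  | n + 1 => 2 * prefixNat c y n + (y n).toNat

theorem oraclePartrec_prefixNat (c : ℕ) :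
    OraclePartrec fun o n => Part.some (prefixNat c o n) := by
  have hstep : OraclePartrec fun o n =>
      Part.some (2 * n.unpair.2.unpair.2 + (o n.unpair.2.unpair.1).toNat) := by
    have h2 : Primrec fun n : ℕ => 2 * n.unpair.2.unpair.2 :=
      Primrec.nat_double.comp (Primrec.snd.comp
        (Primrec.unpair.comp (Primrec.snd.comp Primrec.unpair)))
    have h1 : Primrec fun n : ℕ => n.unpair.2.unpair.1 :=
      Primrec.fst.comp (Primrec.unpair.comp (Primrec.snd.comp Primrec.unpair))
    have hadd : Primrec fun n : ℕ => n.unpair.1 + n.unpair.2 :=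
      Primrec.nat_add.comp (Primrec.fst.comp Primrec.unpair) (Primrec.snd.comp Primrec.unpair)
    have h := OraclePartrec.comp_total (.of_primrec hadd)
      (OraclePartrec.pair_total (.of_primrec h2)
        (OraclePartrec.comp_total .query (.of_primrec h1)))
    simpa using h
  have hrec := OraclePartrec.prec (.of_primrec (Primrec.const c)) hstep
  have hin : Primrec fun n : ℕ => Nat.pair 0 n :=
    Primrec₂.natPair.comp (Primrec.const 0) Primrec.id
  have h := OraclePartrec.comp hrec (.of_primrec hin)
  refine (congrArg OraclePartrec ?_).mp h
  funext o n
  simp only [Part.bind_eq_bind, Part.bind_some, Nat.unpaired, Nat.unpair_pair]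
  induction n with
  | zero => rfl
  | succ n ih => simp [ih, prefixNat]

/-- Post-processing the output `σ` of a computable function by a primitive recursive function
that also sees the first `3 * |σ|` oracle bits is again computable. -/
theorem IsComputable.map_prefix {U : (ℕ → Bool) → List Bool →. List Bool} (hU : IsComputable U)
    {H : ℕ → List Bool → List Bool} (hH : Primrec₂ H) :
    IsComputable fun o p => (U o p).map fun σ => H (prefixNat 1 o (3 * σ.length)) σ := by
  have hdec : Primrec fun n : ℕ => (Encodable.decode (α := List Bool) n).getD [] :=
    Primrec.option_getD.comp Primrec.decode (Primrec.const [])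
  have hlen : Primrec fun n : ℕ =>
      3 * ((Encodable.decode (α := List Bool) n).getD []).length :=
    Primrec.nat_mul.comp (Primrec.const 3) (Primrec.list_length.comp hdec)
  have hpost : Primrec fun n : ℕ => Encodable.encode
      (H n.unpair.1 ((Encodable.decode (α := List Bool) n.unpair.2).getD [])) :=
    Primrec.encode.comp (hH.comp (Primrec.fst.comp Primrec.unpair)
      (hdec.comp (Primrec.snd.comp Primrec.unpair)))
  have h := OraclePartrec.comp (OraclePartrec.comp_total (.of_primrec hpost)
    (OraclePartrec.pair_total
      (OraclePartrec.comp_total (oraclePartrec_prefixNat 1) (.of_primrec hlen))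
      (.of_primrec Primrec.id))) hU
  unfold IsComputable
  refine (congrArg OraclePartrec ?_).mp h
  funext o n
  simp only [Part.bind_eq_bind, Part.bind_assoc, Part.bind_map, Nat.unpair_pair, id,
    Encodable.encodek, Option.getD_some]
  congr 1
  funext x
  rw [Part.map_map]
  exact Part.bind_some_eq_map _ _

theorem isComputable_id : IsComputable fun _ p => Part.some p :=
  OraclePartrec.of_partrec (Partrec.some (α := List Bool))

/-! ### Complexity under computable post-processing -/

/-- The minimum defining the complexity is attained: the universal function simulates the identity,
so every string has a program. -/
theorem exists_program {U : (ℕ → Bool) → List Bool →. List Bool} (hU : IsUniversal U)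
    (x : List Bool) (o : ℕ → Bool) :
    ∃ p : List Bool, p.length = complexity U x o ∧ x ∈ U o p := by
  obtain ⟨q, hq⟩ := hU.2 _ isComputable_id
  refine Nat.sInf_mem (s := {l : ℕ | ∃ p : List Bool, p.length = l ∧ x ∈ U o p})
    ⟨_, pairing q x, rfl, ?_⟩
  rw [← hq]
  exact Part.mem_some x

/-- Post-processing raises the complexity by at most a constant that does not depend on the
oracle. -/
theorem complexity_postprocess_le {U : (ℕ → Bool) → List Bool →. List Bool} (hU : IsUniversal U)
    {H : ℕ → List Bool → List Bool} (hH : Primrec₂ H) :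
    ∃ C : ℕ, ∀ (o : ℕ → Bool) (σ : List Bool),
      complexity U (H (prefixNat 1 o (3 * σ.length)) σ) o ≤ complexity U σ o + C := by
  obtain ⟨q, hq⟩ := hU.2 _ (hU.1.map_prefix hH)
  refine ⟨2 * q.length + 1, fun o σ => ?_⟩
  obtain ⟨p, hp, hσ⟩ := exists_program hU σ o
  refine Nat.sInf_le ⟨pairing q p, ?_, ?_⟩
  · simp only [pairing, List.length_append, List.length_replicate, List.length_cons]
    omega
  · rw [← hq]
    exact Part.mem_map _ hσ

/-! ### Decoding a prefix with finite advice -/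

/-- The last `n` binary digits of `Y`, most significant digit first. -/
def binaryDigits (n Y : ℕ) : List Bool :=
  (List.range n).map fun i => decide (Y / 2 ^ (n - 1 - i) % 2 = 1)

/-- The numerator of `∑ σ_i (b / B)^{-i}` over the common denominator `b ^ |σ|`. -/
def valueNumerator (b B : ℕ) : List Bool → ℕ
  | [] => 0
  | c :: t => (c.toNat * b ^ t.length + valueNumerator b B t) * B

/-- The largest `k ≤ m` with `2 ^ k ≤ (b / B) ^ m`. -/
def lengthEstimate (b B m : ℕ) : ℕ :=
  Nat.findGreatest (fun k => 2 ^ k * B ^ m ≤ b ^ m) m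

/-- The approximation `b / 8 ^ |σ|` of the base turns `σ` into a binary string; the advice `d`
corrects its length, and `j`, `k` correct the integer that it encodes. -/
def decodePrefix (d j k b : ℕ) (σ : List Bool) : List Bool :=
  let B := 8 ^ σ.length
  let n := lengthEstimate b B σ.length + d
  binaryDigits n (2 ^ n * valueNumerator b B σ / b ^ σ.length + j - k)

theorem primrec_pow : Primrec₂ fun a b : ℕ => a ^ b :=
  Primrec₂.unpaired'.1 Nat.Primrec.pow

theorem primrec_binaryDigits : Primrec₂ binaryDigits := by
  refine Primrec.list_map (Primrec.list_range.comp Primrec.fst) ?_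
  refine PrimrecPred.decide (Primrec.eq.comp (Primrec.nat_mod.comp (Primrec.nat_div.comp
    (Primrec.snd.comp Primrec.fst) (primrec_pow.comp (Primrec.const 2)
      (Primrec.nat_sub.comp (Primrec.nat_sub.comp (Primrec.fst.comp Primrec.fst)
        (Primrec.const 1)) Primrec.snd))) (Primrec.const 2)) (Primrec.const 1))

theorem primrec_toNat : Primrec Bool.toNat :=
  Primrec.dom_finite _

/-- `valueNumerator` as a fold whose state also carries the denominator. -/
theorem foldr_valueNumerator (b B : ℕ) (σ : List Bool) :
    σ.foldr (fun c s => ((c.toNat * s.2 + s.1) * B, b * s.2)) ((0, 1) : ℕ × ℕ) =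
      (valueNumerator b B σ, b ^ σ.length) := by
  induction σ with
  | nil => rfl
  | cons c t ih => simp [ih, valueNumerator, pow_succ']

theorem primrec_valueNumerator {α : Type*} [Primcodable α] {b B : α → ℕ} {σ : α → List Bool}
    (hb : Primrec b) (hB : Primrec B) (hσ : Primrec σ) :
    Primrec fun a => valueNumerator (b a) (B a) (σ a) := by
  have hstep : Primrec₂ fun (a : α) (p : Bool × (ℕ × ℕ)) =>
      ((p.1.toNat * p.2.2 + p.2.1) * B a, b a * p.2.2) :=
    Primrec.pair
      (Primrec.nat_mul.comp (Primrec.nat_add.comp (Primrec.nat_mul.comp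
        (primrec_toNat.comp (Primrec.fst.comp Primrec.snd))
        (Primrec.snd.comp (Primrec.snd.comp Primrec.snd)))
        (Primrec.fst.comp (Primrec.snd.comp Primrec.snd))) (hB.comp Primrec.fst))
      (Primrec.nat_mul.comp (hb.comp Primrec.fst) (Primrec.snd.comp (Primrec.snd.comp Primrec.snd)))
  refine (Primrec.fst.comp (Primrec.list_foldr hσ (Primrec.const ((0, 1) : ℕ × ℕ)) hstep)).of_eq
    fun a => ?_
  exact congrArg Prod.fst (foldr_valueNumerator (b a) (B a) (σ a))

theorem primrec_lengthEstimate {α : Type*} [Primcodable α] {b B m : α → ℕ}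
    (hb : Primrec b) (hB : Primrec B) (hm : Primrec m) :
    Primrec fun a => lengthEstimate (b a) (B a) (m a) := by
  refine Primrec.nat_findGreatest hm
    (p := fun a k => 2 ^ k * B a ^ m a ≤ b a ^ m a) ?_
  exact Primrec.nat_le.comp
    (Primrec.nat_mul.comp (primrec_pow.comp (Primrec.const 2) Primrec.snd)
      (primrec_pow.comp (hB.comp Primrec.fst) (hm.comp Primrec.fst)))
    (primrec_pow.comp (hb.comp Primrec.fst) (hm.comp Primrec.fst))

theorem primrec_decodePrefix (d j k : ℕ) : Primrec₂ (decodePrefix d j k) := by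
  have hm : Primrec fun a : ℕ × List Bool => a.2.length := Primrec.list_length.comp Primrec.snd
  have hB : Primrec fun a : ℕ × List Bool => 8 ^ a.2.length :=
    primrec_pow.comp (Primrec.const 8) hm
  have hn : Primrec fun a : ℕ × List Bool =>
      lengthEstimate a.1 (8 ^ a.2.length) a.2.length + d :=
    Primrec.nat_add.comp (primrec_lengthEstimate Primrec.fst hB hm) (Primrec.const d)
  exact primrec_binaryDigits.comp hn (Primrec.nat_sub.comp (Primrec.nat_add.comp
    (Primrec.nat_div.comp (Primrec.nat_mul.comp (primrec_pow.comp (Primrec.const 2) hn)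
      (primrec_valueNumerator Primrec.fst hB Primrec.snd)) (primrec_pow.comp Primrec.fst hm))
    (Primrec.const j)) (Primrec.const k))

/-! ### Greedy binary expansions -/

theorem greedyRem_succ (s : ℝ) (n : ℕ) :
    greedyRem s (n + 1) = 2 * greedyRem s n - ((greedyBinary s n).toNat : ℝ) := by
  rw [greedyRem, greedyBinary]
  split_ifs <;> simp

theorem greedyRem_mem {s : ℝ} (hs : s ∈ Set.Icc (0 : ℝ) 1) (n : ℕ) :
    greedyRem s n ∈ Set.Icc (0 : ℝ) 1 := by
  induction n with
  | zero => exact hs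
  | succ n ih =>
    obtain ⟨h0, h1⟩ := ih
    by_cases h : greedyRem s n < 1 / 2
    · rw [greedyRem, if_pos h]
      constructor <;> linarith
    · rw [greedyRem, if_neg h]
      constructor <;> linarith

/-- Reading `n` greedy binary digits of `s` off `c + s` leaves exactly the remainder of the greedy
algorithm. It lies in `[0, 1]`, and equals `1` throughout when `s = 1`. -/
theorem two_pow_mul_eq (c : ℕ) (s : ℝ) (n : ℕ) :
    2 ^ n * (c + s) = prefixNat c (greedyBinary s) n + greedyRem s n := by
  induction n with
  | zero => simp [prefixNat, greedyRem]
  | succ n ih =>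
    rw [greedyRem_succ, prefixNat, pow_succ, mul_right_comm, ih]
    push_cast
    ring

theorem binaryDigits_succ (n Y : ℕ) :
    binaryDigits (n + 1) Y = binaryDigits n (Y / 2) ++ [decide (Y % 2 = 1)] := by
  simp only [binaryDigits, List.range_succ, List.map_append, List.map_cons, List.map_nil,
    Nat.add_sub_cancel, Nat.sub_self, pow_zero, Nat.div_one]
  congr 1
  refine List.map_congr_left fun i hi => ?_
  have hi := List.mem_range.1 hi
  rw [Nat.div_div_eq_div_mul, ← pow_succ', show n - 1 - i + 1 = n - i by omega]

theorem binaryDigits_prefixNat (y : ℕ → Bool) (n : ℕ) :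
    binaryDigits n (prefixNat 0 y n) = prefixOf y n := by
  induction n with
  | zero => rfl
  | succ n ih =>
    have h1 : (2 * prefixNat 0 y n + (y n).toNat) / 2 = prefixNat 0 y n := by
      have := (y n).toNat_lt
      omega
    have h2 : decide ((2 * prefixNat 0 y n + (y n).toNat) % 2 = 1) = y n := by
      cases y n <;> simp
    rw [binaryDigits_succ, prefixNat, h1, h2, ih]
    simp [prefixOf, List.range_succ]

/-! ### Values of finite prefixes -/

/-- The number `∑ σ_i γ^{-i}` of a finite string in base `γ`. -/
noncomputable def listValue (γ : ℝ) : List Bool → ℝ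
  | [] => 0
  | c :: t => ((c.toNat : ℝ) + listValue γ t) / γ

theorem toNat_le_one (c : Bool) : (c.toNat : ℝ) ≤ 1 := by
  exact_mod_cast c.toNat_le

theorem listValue_nonneg {γ : ℝ} (hγ : 1 ≤ γ) (σ : List Bool) : 0 ≤ listValue γ σ := by
  induction σ with
  | nil => exact le_rfl
  | cons c t ih => rw [listValue]; positivity

theorem listValue_le_length {γ : ℝ} (hγ : 1 ≤ γ) (σ : List Bool) :
    listValue γ σ ≤ σ.length := by
  induction σ with
  | nil => simp [listValue]
  | cons c t ih =>
    have := listValue_nonneg hγ t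
    rw [listValue, List.length_cons]
    push_cast
    exact (div_le_self (by positivity) hγ).trans (by linarith [toNat_le_one c])

theorem listValue_anti {γ β : ℝ} (hγ : 1 ≤ γ) (hle : γ ≤ β) (σ : List Bool) :
    listValue β σ ≤ listValue γ σ := by
  induction σ with
  | nil => exact le_rfl
  | cons c t ih =>
    have := listValue_nonneg hγ t
    rw [listValue, listValue]
    gcongr

theorem listValue_le_add {γ β : ℝ} (hγ : 1 ≤ γ) (hle : γ ≤ β) (σ : List Bool) :
    listValue γ σ ≤ listValue β σ + (σ.length : ℝ) ^ 2 * (β - γ) := by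
  induction σ with
  | nil => simp [listValue]
  | cons c t ih =>
    have hβ : 1 ≤ β := hγ.trans hle
    have h0 := listValue_nonneg hβ t
    have h1 := listValue_le_length hβ t
    have h2 := listValue_anti hγ hle t
    have hc := toNat_le_one c
    have hc0 : (0 : ℝ) ≤ c.toNat := by positivity
    rw [listValue, listValue, List.length_cons]
    push_cast
    set u := listValue γ t
    set v := listValue β t
    set l : ℝ := (t.length : ℝ)
    have hl : 0 ≤ l := Nat.cast_nonneg _
    have e1 : (c.toNat + u) / γ =
        (c.toNat + v) / β + ((u - v) / γ + (c.toNat + v) * ((β - γ) / (γ * β))) := by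
      field_simp
      ring
    have e2 : (u - v) / γ ≤ l ^ 2 * (β - γ) := (div_le_self (by linarith) hγ).trans (by linarith)
    have e3 : (β - γ) / (γ * β) ≤ β - γ :=
      div_le_self (by linarith) (by nlinarith)
    have e4 : (c.toNat + v) * ((β - γ) / (γ * β)) ≤ (1 + l) * (β - γ) :=
      mul_le_mul (by linarith) e3 (div_nonneg (by linarith) (by positivity)) (by linarith)
    have e5 : 0 ≤ l * (β - γ) := mul_nonneg hl (by linarith)
    rw [e1]
    nlinarith

theorem valueNumerator_div {b B : ℕ} (hb : 0 < b) (hB : 0 < B) (σ : List Bool) :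
    (valueNumerator b B σ : ℝ) / (b : ℝ) ^ σ.length = listValue (b / B) σ := by
  induction σ with
  | nil => simp [valueNumerator, listValue]
  | cons c t ih =>
    rw [valueNumerator, listValue, ← ih, List.length_cons]
    push_cast
    field_simp
    ring

theorem summable_value {β : ℝ} (hβ : 1 < β) (x : ℕ → Bool) :
    Summable fun i : ℕ => ((x i).toNat : ℝ) * (β ^ (i + 1))⁻¹ := by
  have hg : Summable fun i : ℕ => (β⁻¹) ^ (i + 1) :=
    (summable_nat_add_iff 1).2
      (summable_geometric_of_lt_one (by positivity) (inv_lt_one_of_one_lt₀ hβ))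
  refine Summable.of_nonneg_of_le (fun i => by positivity) (fun i => ?_) hg
  rw [inv_pow]
  exact mul_le_of_le_one_left (by positivity) (toNat_le_one _)

theorem value_nonneg {β : ℝ} (hβ : 1 < β) (x : ℕ → Bool) : 0 ≤ value β x :=
  tsum_nonneg fun i => by positivity

theorem value_le {β : ℝ} (hβ : 1 < β) (x : ℕ → Bool) : value β x ≤ 1 / (β - 1) := by
  have hβ' : β⁻¹ < 1 := inv_lt_one_of_one_lt₀ hβ
  have hg := (hasSum_geometric_of_lt_one (by positivity) hβ').mul_left β⁻¹
  have e : β⁻¹ * (1 - β⁻¹)⁻¹ = 1 / (β - 1) := by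
    have : β - 1 ≠ 0 := by linarith
    have : 1 - β⁻¹ ≠ 0 := by linarith
    field_simp
  rw [e] at hg
  refine hasSum_le (fun i => ?_) (summable_value hβ x).hasSum hg
  rw [← pow_succ', inv_pow]
  exact mul_le_of_le_one_left (by positivity) (toNat_le_one _)

theorem value_eq_shift {β : ℝ} (hβ : 1 < β) (x : ℕ → Bool) :
    value β x = ((x 0).toNat + value β fun i => x (i + 1)) / β := by
  rw [value, (summable_value hβ x).tsum_eq_zero_add, value, add_div, div_eq_mul_inv _ β,
    div_eq_mul_inv _ β, ← tsum_mul_right]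
  congr 1
  · simp
  · refine tsum_congr fun i => ?_
    rw [pow_succ β (i + 1), mul_inv, mul_assoc]

theorem prefixOf_succ (x : ℕ → Bool) (m : ℕ) :
    prefixOf x (m + 1) = x 0 :: prefixOf (fun i => x (i + 1)) m := by
  simp [prefixOf, List.range_succ_eq_map, Function.comp_def]

theorem value_bounds {β : ℝ} (hβ : 1 < β) (x : ℕ → Bool) (m : ℕ) :
    listValue β (prefixOf x m) ≤ value β x ∧
      value β x ≤ listValue β (prefixOf x m) + 1 / (β - 1) / β ^ m := by
  induction m generalizing x with
  | zero =>
    have h := value_le hβ x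
    simp only [prefixOf, List.range_zero, List.map_nil, listValue, pow_zero, div_one, zero_add]
    exact ⟨value_nonneg hβ x, h⟩
  | succ m ih =>
    obtain ⟨h1, h2⟩ := ih fun i => x (i + 1)
    have hβ0 : 0 < β := by linarith
    rw [prefixOf_succ, value_eq_shift hβ, listValue, pow_succ, ← div_div _ (β ^ m) β, ← add_div]
    constructor
    · gcongr
    · rw [add_assoc]
      gcongr

/-! ### Finitely many candidates for the binary prefix -/

theorem pow_betaLength {β : ℝ} (hβ : β ∈ Set.Ioo (1 : ℝ) 2) (n : ℕ) :
    n ≤ betaLength β n ∧ 2 ^ n ≤ β ^ betaLength β n ∧ β ^ betaLength β n < 2 ^ (n + 1) := by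
  obtain ⟨h1, h2⟩ := hβ
  have hβ0 : 0 < β := by linarith
  set t := Real.logb β 2 with ht
  have ht1 : 1 < t := (Real.lt_logb_iff_rpow_lt h1 two_pos).2 (by simpa using h2)
  have hβt : β ^ t = 2 := Real.rpow_logb hβ0 h1.ne' two_pos
  have hpow : ∀ k : ℕ, (2 : ℝ) ^ k = β ^ ((k : ℝ) * t) := fun k => by
    rw [mul_comm, Real.rpow_mul hβ0.le, hβt, Real.rpow_natCast]
  have hle : (n : ℝ) * t ≤ betaLength β n := Nat.le_ceil _
  have hlt : (betaLength β n : ℝ) < n * t + 1 := Nat.ceil_lt_add_one (by positivity)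
  refine ⟨?_, ?_, ?_⟩
  · have : (n : ℝ) ≤ betaLength β n := by nlinarith [(Nat.cast_nonneg n : (0 : ℝ) ≤ n)]
    exact_mod_cast this
  · rw [hpow, ← Real.rpow_natCast]
    exact Real.rpow_le_rpow_of_exponent_le h1.le hle
  · rw [hpow, ← Real.rpow_natCast]
    refine Real.rpow_lt_rpow_of_exponent_lt h1 ?_
    push_cast
    linarith

theorem eight_pow_eq (m : ℕ) : (8 : ℝ) ^ m = 2 ^ m * 2 ^ m * 2 ^ m := by
  rw [← mul_pow, ← mul_pow]
  norm_num

/-- An approximation of the base within `8 ^ (-m)` determines `n` from `m = n(β)` up to one. -/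
theorem lengthEstimate_betaLength {β : ℝ} (hβ : β ∈ Set.Ioo (1 : ℝ) 2) (n b : ℕ)
    (hb : (b : ℝ) ≤ 8 ^ betaLength β n * β) (hb' : 8 ^ betaLength β n * β ≤ (b : ℝ) + 1) :
    ∃ d ≤ 1, lengthEstimate b (8 ^ betaLength β n) (betaLength β n) + d = n := by
  obtain ⟨hnm, hlo, hhi⟩ := pow_betaLength hβ n
  obtain ⟨h1, h2⟩ := hβ
  set m := betaLength β n
  have h8 : (0 : ℝ) < 8 ^ m := by positivity
  have hiff : ∀ k : ℕ, 2 ^ k * (8 ^ m) ^ m ≤ b ^ m ↔ (2 : ℝ) ^ k ≤ ((b : ℝ) / 8 ^ m) ^ m := by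
    intro k
    rw [div_pow, le_div_iff₀ (by positivity)]
    exact_mod_cast Iff.rfl
  have hγ0 : 0 ≤ (b : ℝ) / 8 ^ m := by positivity
  have hγβ : (b : ℝ) / 8 ^ m ≤ β := by
    rw [div_le_iff₀ h8]; linarith
  set e := lengthEstimate b (8 ^ m) m with he
  -- the estimate never exceeds `n`, because the base is approximated from below
  have hen : e ≤ n := by
    have hspec : 2 ^ e * (8 ^ m) ^ m ≤ b ^ m ∨ e = 0 := by
      by_cases h : e = 0
      · exact Or.inr h
      · exact Or.inl (Nat.findGreatest_of_ne_zero
          (P := fun k => 2 ^ k * (8 ^ m) ^ m ≤ b ^ m) he.symm h)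
    rcases hspec with h | h
    · have h3 : (2 : ℝ) ^ e < 2 ^ (n + 1) :=
        (((hiff e).1 h).trans (pow_le_pow_left₀ hγ0 hγβ m)).trans_lt hhi
      have := (pow_lt_pow_iff_right₀ (one_lt_two : (1 : ℝ) < 2)).1 h3
      omega
    · omega
  have hne : n ≤ e + 1 := by
    rcases Nat.eq_zero_or_pos n with h | hn
    · omega
    have hm : 1 ≤ m := le_trans hn hnm
    have hratio : 1 - 1 / (8 : ℝ) ^ m ≤ (b : ℝ) / 8 ^ m / β := by
      rw [le_div_iff₀ (by linarith), le_div_iff₀ h8]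
      have : (1 - 1 / (8 : ℝ) ^ m) * β * 8 ^ m = 8 ^ m * β - β := by field_simp
      rw [this]
      linarith
    have hm2 : (m : ℝ) ≤ 2 ^ m := by exact_mod_cast (Nat.lt_two_pow_self (n := m)).le
    have h2m : (2 : ℝ) ≤ 2 ^ m := by
      simpa using pow_le_pow_right₀ (one_le_two : (1 : ℝ) ≤ 2) hm
    have h8le : 2 * (m : ℝ) ≤ 8 ^ m := by
      rw [eight_pow_eq]
      nlinarith [(Nat.cast_nonneg m : (0 : ℝ) ≤ m)]
    have hsmall : (m : ℝ) * (1 / 8 ^ m) ≤ 1 / 2 := by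
      rw [mul_one_div, div_le_iff₀ h8]
      linarith
    have hinv : 1 / (8 : ℝ) ^ m ≤ 1 := by
      rw [div_le_one h8]
      exact one_le_pow₀ (by norm_num)
    -- Bernoulli's inequality: the `m`-th powers of the base and its approximation differ by a
    -- factor of at most two
    have hbern : 1 / 2 ≤ ((b : ℝ) / 8 ^ m / β) ^ m := by
      have := one_add_mul_le_pow (a := -(1 / (8 : ℝ) ^ m)) (by linarith) m
      calc (1 : ℝ) / 2 ≤ 1 + m * -(1 / (8 : ℝ) ^ m) := by linarith
        _ ≤ (1 + -(1 / (8 : ℝ) ^ m)) ^ m := this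
        _ ≤ _ := pow_le_pow_left₀ (by linarith) (by linarith) m
    have hβm : 0 < β ^ m := by positivity
    rw [div_pow _ β, le_div_iff₀ hβm] at hbern
    have hpred : (2 : ℝ) ^ n = 2 ^ (n - 1) * 2 := by rw [← pow_succ, Nat.sub_add_cancel hn]
    have h3 : (2 : ℝ) ^ (n - 1) ≤ ((b : ℝ) / 8 ^ m) ^ m := by linarith
    have := Nat.le_findGreatest (P := fun k => 2 ^ k * (8 ^ m) ^ m ≤ b ^ m)
      (show n - 1 ≤ m by omega) ((hiff _).2 h3)
    have : n - 1 ≤ e := this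
    omega
  exact ⟨n - e, by omega, by omega⟩

/-- The first `n(β)` digits in base `β` and the oracle determine the first `n` binary digits up
to boundedly many possibilities. -/
theorem exists_decodePrefix {β : ℝ} (hβ : β ∈ Set.Ioo (1 : ℝ) 2) {x : ℕ → Bool}
    (hx : x ∈ Omega β) (n : ℕ) :
    ∃ d ≤ 1, ∃ j ≤ ⌈1 / (β - 1)⌉₊ + 3,
      decodePrefix d j 2
        (prefixNat 1 (greedyBinary (β - 1)) (3 * (prefixOf x (betaLength β n)).length))
        (prefixOf x (betaLength β n)) = prefixOf (greedyBinary (value β x)) n := by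
  have hlen : (prefixOf x (betaLength β n)).length = betaLength β n := by simp [prefixOf]
  rw [hlen]
  obtain ⟨hnm, hlo, -⟩ := pow_betaLength hβ n
  have hest := lengthEstimate_betaLength hβ n
  obtain ⟨h1, h2⟩ := hβ
  set m := betaLength β n
  set σ := prefixOf x m
  set b := prefixNat 1 (greedyBinary (β - 1)) (3 * m)
  have h8 : (0 : ℝ) < 8 ^ m := by positivity
  have hb : 8 ^ m * β = b + greedyRem (β - 1) (3 * m) := by
    have := two_pow_mul_eq 1 (β - 1) (3 * m)
    rw [pow_mul] at this
    norm_num at this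
    exact this
  have hrem := greedyRem_mem (s := β - 1) ⟨by linarith, by linarith⟩ (3 * m)
  have hble : (b : ℝ) ≤ 8 ^ m * β := by linarith [hrem.1]
  have hbge : 8 ^ m * β ≤ (b : ℝ) + 1 := by linarith [hrem.2]
  obtain ⟨d, hd, hdn⟩ := hest b hble hbge
  have hb8 : (8 : ℝ) ^ m ≤ b := by
    have h : (8 : ℝ) ^ m < b + 1 := lt_of_lt_of_le (by nlinarith) hbge
    have h' : 8 ^ m < b + 1 := by exact_mod_cast h
    exact_mod_cast Nat.lt_succ_iff.1 h'
  have hb0 : 0 < b := by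
    have : (0 : ℝ) < b := by linarith
    exact_mod_cast this
  set γ : ℝ := (b : ℝ) / 8 ^ m with hγ
  have hγ1 : 1 ≤ γ := (one_le_div h8).2 hb8
  have hγβ : γ ≤ β := by rw [hγ, div_le_iff₀ h8]; linarith
  have hdiff : β - γ ≤ 1 / 8 ^ m := by
    rw [hγ, le_div_iff₀ h8, sub_mul, div_mul_cancel₀ _ h8.ne']
    linarith
  obtain ⟨hv1, hv2⟩ := value_bounds h1 x m
  have hw1 := listValue_anti hγ1 hγβ σ
  have hw2 := listValue_le_add hγ1 hγβ σ
  rw [hlen] at hw2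
  have hnum : (valueNumerator b (8 ^ m) σ : ℝ) / (b : ℝ) ^ m = listValue γ σ := by
    have := valueNumerator_div hb0 (B := 8 ^ m) (by positivity) σ
    rw [hlen] at this
    rw [this, hγ]
    push_cast
    rfl
  have hs := two_pow_mul_eq 0 (value β x) n
  have hsrem := greedyRem_mem (s := value β x) ⟨value_nonneg h1 x, hx⟩ n
  set s := value β x
  set Y := prefixNat 0 (greedyBinary s) n with hY
  rw [Nat.cast_zero, zero_add] at hs
  set q := 2 ^ n * valueNumerator b (8 ^ m) σ / b ^ m with hq
  have hqfloor : q = ⌊(2 : ℝ) ^ n * listValue γ σ⌋₊ := by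
    rw [← hnum, hq, ← mul_div_assoc, ← Nat.floor_div_eq_div (K := ℝ)]
    push_cast
    rfl
  have hwnn : 0 ≤ (2 : ℝ) ^ n * listValue γ σ :=
    mul_nonneg (by positivity) (listValue_nonneg hγ1 σ)
  have hq1 : (q : ℝ) ≤ 2 ^ n * listValue γ σ := hqfloor ▸ Nat.floor_le hwnn
  have hq2 : 2 ^ n * listValue γ σ < (q : ℝ) + 1 := hqfloor ▸ Nat.lt_floor_add_one _
  have h2n : (0 : ℝ) < 2 ^ n := by positivity
  have hβ1 : 0 < 1 / (β - 1) := one_div_pos.2 (by linarith)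
  -- the digits of `x` beyond the prefix contribute at most `1 / (β - 1)` at scale `2 ^ n`
  have htail : 2 ^ n * (1 / (β - 1) / β ^ m) ≤ 1 / (β - 1) := by
    rw [← mul_div_assoc, div_le_iff₀ (by positivity), mul_comm]
    gcongr
  -- replacing `β` by its approximation costs at most `m ^ 2 / 4 ^ m ≤ 1` at scale `2 ^ n`
  have happrox : 2 ^ n * ((m : ℝ) ^ 2 * (β - γ)) ≤ 1 := by
    have hm2 : (m : ℝ) ≤ 2 ^ m := by exact_mod_cast (Nat.lt_two_pow_self (n := m)).le
    calc 2 ^ n * ((m : ℝ) ^ 2 * (β - γ))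
        ≤ 2 ^ m * ((2 ^ m) ^ 2 * (1 / 8 ^ m)) := by
          have : (0 : ℝ) ≤ β - γ := by linarith
          gcongr
          · norm_num
      _ = 1 := by
          rw [eight_pow_eq]
          field_simp
  have hYup : Y ≤ q + (⌈1 / (β - 1)⌉₊ + 1) := by
    have h3 : 2 ^ n * s ≤ 2 ^ n * (listValue γ σ + 1 / (β - 1) / β ^ m) :=
      mul_le_mul_of_nonneg_left (by linarith) h2n.le
    have h4 : (Y : ℝ) ≤ q + (⌈1 / (β - 1)⌉₊ + 1) := by
      have := Nat.le_ceil (1 / (β - 1))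
      linarith [hsrem.1]
    exact_mod_cast h4
  have hYlo : q ≤ Y + 2 := by
    have h3 : 2 ^ n * listValue γ σ ≤ 2 ^ n * (s + (m : ℝ) ^ 2 * (β - γ)) :=
      mul_le_mul_of_nonneg_left (by linarith) h2n.le
    have h4 : (q : ℝ) ≤ Y + 2 := by linarith [hsrem.2]
    exact_mod_cast h4
  refine ⟨d, hd, Y + 2 - q, by omega, ?_⟩
  simp only [decodePrefix, hlen, hdn]
  rw [← hq, show q + (Y + 2 - q) - 2 = Y by omega]
  exact binaryDigits_prefixNat _ n

theorem exists_complexityRel_bound {U : (ℕ → Bool) → List Bool →. List Bool}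
    (hU : IsUniversal U) {β : ℝ} (hβ : β ∈ Set.Ioo (1 : ℝ) 2) :
    ∃ C : ℕ, ∀ x ∈ Omega β, ∀ n : ℕ,
      complexityRel U β (prefixOf (greedyBinary (value β x)) n) ≤
        complexityRel U β (prefixOf x (betaLength β n)) + C := by
  choose c hc using fun d j : ℕ => complexity_postprocess_le hU (primrec_decodePrefix d j 2)
  set J := ⌈1 / (β - 1)⌉₊ + 3 with hJ
  refine ⟨∑ d ∈ Finset.range 2, ∑ j ∈ Finset.range (J + 1), c d j, fun x hx n => ?_⟩
  obtain ⟨d, hd, j, hj, h⟩ := exists_decodePrefix hβ hx n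
  have hle : c d j ≤ ∑ d ∈ Finset.range 2, ∑ j ∈ Finset.range (J + 1), c d j :=
    (Finset.single_le_sum (f := fun j => c d j) (fun _ _ => Nat.zero_le _)
      (Finset.mem_range.2 (Nat.lt_succ_of_le hj))).trans
    (Finset.single_le_sum (f := fun d => ∑ j ∈ Finset.range (J + 1), c d j)
      (fun _ _ => Nat.zero_le _) (Finset.mem_range.2 (by omega)))
  have := hc d j (greedyBinary (β - 1)) (prefixOf x (betaLength β n))
  rw [h] at this
  exact this.trans (Nat.add_le_add_left hle _)

theorem lowerDelta_nonneg {U : (ℕ → Bool) → List Bool →. List Bool} {β : ℝ} {x : ℕ → Bool} {C : ℕ}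
    (h : ∀ n : ℕ, complexityRel U β (prefixOf (greedyBinary (value β x)) n) ≤
      complexityRel U β (prefixOf x (betaLength β n)) + C) :
    0 ≤ lowerDelta U β x := by
  have hlim : Tendsto (fun n : ℕ => ((-(C : ℝ) / n : ℝ) : EReal)) atTop (nhds 0) := by
    have := tendsto_const_div_atTop_nhds_zero_nat (-(C : ℝ))
    exact_mod_cast (continuous_coe_real_ereal.tendsto 0).comp this
  rw [← hlim.liminf_eq]
  refine liminf_le_liminf (Eventually.of_forall fun n => ?_)
  rw [EReal.coe_le_coe_iff, complexityGap]
  have : (complexityRel U β (prefixOf (greedyBinary (value β x)) n) : ℝ) ≤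
      complexityRel U β (prefixOf x (betaLength β n)) + C := by exact_mod_cast h n
  gcongr
  linarith

end BetaExp

theorem mainTheorem2 (U : (ℕ → Bool) → List Bool →. List Bool) (hU : BetaExp.IsUniversal U)
    (β : ℝ) (hβ : β ∈ Set.Ioo (1 : ℝ) 2) :
    (∃ C : ℕ, ∀ x ∈ BetaExp.Omega β, ∀ n : ℕ,
      BetaExp.complexityRel U β (BetaExp.prefixOf (BetaExp.greedyBinary (BetaExp.value β x)) n) ≤
        BetaExp.complexityRel U β (BetaExp.prefixOf x (BetaExp.betaLength β n)) + C) ∧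
    ∀ x ∈ BetaExp.Omega β,
      0 ≤ BetaExp.lowerDelta U β x ∧ BetaExp.lowerDelta U β x ≤ BetaExp.upperDelta U β x := by
  obtain ⟨C, hC⟩ := BetaExp.exists_complexityRel_bound hU hβ
  exact ⟨⟨C, hC⟩, fun x hx =>
    ⟨BetaExp.lowerDelta_nonneg (hC x hx), Filter.liminf_le_limsup⟩⟩
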